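/- **Setting.** A second countable topological graph $E=(E^0,E^1,r,s)$ consists of second countable locally compact Hausdorff spaces $E^0$ (vertices) and $E^1$ (edges), a continuous map $r:E^1\to E^0$ (range) and a local homeomorphism $s:E^1\to E^0$ (source). Let $E^n$ ($n\ge 1$) be the set of paths $\alpha_1\cdots\alpha_n$ of edges with $s(\alpha_i)=r(\alpha_{i+1})$, with the subspace topology from $(E^1)^n$, let $E^*=\bigsqcup_{n\ge 0}E^n$ with the disjoint union topology, and let $E^\infty$ be the set of infinite paths $\alpha_1\alpha_2\cdots$ with $s(\alpha_i)=r(\alpha_{i+1})$. Put $r(\alpha)=r(\alpha_1)$ for paths of positive (possibly infinite) length, $s(\alpha)=s(\alpha_n)$ for $\alpha\in E^n$, $n\ge 1$, and $r(v)=s(v)=v$ for $v\in E^0$. A vertex $v$ is regular if it has an open neighbourhood $W$ such that $\overline W$ and $r^{-1}(\overline W)$ are compact and $r(r^{-1}(W))=W$; otherwise it is singular. Let $E^*_{sng}$ be the set of finite paths (vertices included) with singular source. The boundary path space is $\partial E=E^*_{sng}\sqcup E^\infty$; for $S\subseteq E^*$ let $$Z(S)=\{\alpha\in\partial E : r(\alpha)\in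 S \text{ or } \alpha_1\cdots\alpha_n\in S \text{ for some } 1\le n\le|\alpha|\},$$ and give $\partial E$ the topology generated by the sets $Z(U)\setminus Z(K)$ with $U\subseteq E^*$ open and $K\subseteq E^*$ compact. Let $\sigma:\partial E\setminus E^0\to\partial E$ delete the first edge, with $\sigma(\alpha)=s(\alpha)$ if $|\alpha|=1$. An invariant measure on $\partial E$ is a regular Borel measure $\nu$ with $\nu(\sigma(A))=\nu(A)$ for every Borel set $A\subseteq\partial E\setminus E^0$ on which $\sigma$ is injective. For a Borel measure $\mu$ on $E^0$ let $s^*\mu$ be the Borel measure on $E^1$ with $$\int_{E^1}h\,\mathrm d s^*\mu=\int_{E^0}\sum_{e\in s^{-1}(v)}h(e)\,\mathrm d\mu(v)$$ for all Borel functions $h:E^1\to[0,\infty]$ (if $\mu$ is regular, this is the regular Borel measure given by the same formula for $h\in C_c(E^1)$), and let $T\mu=r_*(s^*\mu)$. **Proposition 2.6.** Let $E$ be a second countable topological graph, let $\nu$ be an invariant measure on $\partial E$, and let $\mu=r_*\nu$, a Borel measure on $E^0$. Then all the measures $T^n\mu$, $n\ge 0$, are regular, and 1. $\nu$ is concentrated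 on $E^\infty$, i.e. $\nu(\partial E\setminus E^\infty)=0$, if and only if $T\mu=\mu$; 2. $\nu$ is concentrated on $E^*_{sng}$, i.e. $\nu(\partial E\setminus E^*_{sng})=0$, if and only if $\lim_{n\to\infty}\int_{E^0}f\,\mathrm d T^n\mu=0$ for all $f\in C_c(E^0)$ (continuous, compactly supported, complex-valued). -/

import Mathlib

open MeasureTheory Set Filter Topology

universe u v

/-- The range and source maps of a topological graph with vertex space `V` and edge space `W`.
The standing assumptions that `V` and `W` are locally compact Hausdorff (and second countable)
are carried by type class arguments. -/
structure TopologicalGraph (V : Type u) (W : Type v) [TopologicalSpace V]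
    [TopologicalSpace W] where
  /-- the range map -/
  r : W → V
  /-- the source map -/
  s : W → V
  continuous_r : Continuous r
  isLocalHomeomorph_s : IsLocalHomeomorph s

namespace TopologicalGraph

variable {V : Type u} {W : Type v} [TopologicalSpace V] [TopologicalSpace W]
  (E : TopologicalGraph V W)

/-! ### Paths -/

/-- Paths with `n + 1` edges, as a subspace of the product of `n + 1` copies of `W`.
The edge `p.1 i` is the `(i + 1)`-st edge of the path. -/
abbrev EdgePath (n : ℕ) : Type v :=
  {p : Fin (n + 1) → W // ∀ i : Fin n, E.s (p i.castSucc) = E.r (p i.succ)}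

/-- The finite path space: the topological disjoint union of the space of vertices (the paths
of length `0`) and of the spaces of paths of length `n + 1`, over all `n : ℕ`. -/
abbrev FinitePath : Type (max u v) := V ⊕ (Σ n : ℕ, E.EdgePath n)

/-- Infinite paths. -/
abbrev InfinitePath : Type v := {p : ℕ → W // ∀ i, E.s (p i) = E.r (p (i + 1))}

/-- The range of a finite path. -/
def FinitePath.range : E.FinitePath → V
  | .inl v => v
  | .inr ⟨_, p⟩ => E.r (p.1 0)

/-- The source of a finite path. -/
def FinitePath.source : E.FinitePath → V
  | .inl v => v
  | .inr ⟨n, p⟩ => E.s (p.1 (Fin.last n))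

/-- The backwards shift on finite paths: it deletes the first edge. On paths of length `0`,
where it is not meant to be used, it is the identity. -/
def FinitePath.shift : E.FinitePath → E.FinitePath
  | .inl v => .inl v
  | .inr ⟨0, p⟩ => .inl (E.s (p.1 0))
  | .inr ⟨n + 1, p⟩ => .inr ⟨n, fun i => p.1 i.succ, fun i => p.2 i.succ⟩

theorem FinitePath.source_shift (α : E.FinitePath) :
    FinitePath.source E (FinitePath.shift E α) = FinitePath.source E α := by
  match α with
  | .inl _ => rfl
  | .inr ⟨0, _⟩ => rfl
  | .inr ⟨_ + 1, _⟩ => rfl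

/-- The set of regular vertices. -/
def regularVertices : Set V :=
  {v | ∃ U : Set V, IsOpen U ∧ v ∈ U ∧ IsCompact (closure U) ∧
    IsCompact (E.r ⁻¹' closure U) ∧ E.r '' (E.r ⁻¹' U) = U}

/-- The set of singular vertices. -/
def singularVertices : Set V := E.regularVerticesᶜ

/-! ### The boundary path space -/

/-- The boundary path space: finite paths with singular source, and infinite paths. -/
inductive BoundaryPath : Type (max u v)
  | fin (α : E.FinitePath) (h : FinitePath.source E α ∈ E.singularVertices) : BoundaryPath
  | inf (α : E.InfinitePath) : BoundaryPath

namespace BoundaryPath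

variable {E}

/-- The range of a boundary path. -/
def range : E.BoundaryPath → V
  | .fin α _ => FinitePath.range E α
  | .inf p => E.r (p.1 0)

/-- The `(i + 1)`-st edge of a boundary path, if the path is long enough. -/
def edge? : E.BoundaryPath → ℕ → Option W
  | .fin (.inl _) _, _ => none
  | .fin (.inr ⟨n, p⟩) _, i => if h : i < n + 1 then some (p.1 ⟨i, h⟩) else none
  | .inf p, i => some (p.1 i)

/-- The path `p` with `n + 1` edges is the initial segment of length `n + 1` of `α`. -/
def HasPrefix (α : E.BoundaryPath) {n : ℕ} (p : E.EdgePath n) : Prop :=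
  ∀ i : Fin (n + 1), α.edge? i = some (p.1 i)

/-- The backwards shift map. It is only meaningful outside of the vertices (the boundary paths
of length `0`), on which this definition makes it the identity. -/
def shift : E.BoundaryPath → E.BoundaryPath
  | .fin α h => .fin (FinitePath.shift E α) ((FinitePath.source_shift E α).symm ▸ h)
  | .inf p => .inf ⟨fun i => p.1 (i + 1), fun i => p.2 (i + 1)⟩

end BoundaryPath

/-- The boundary paths of length `0`, i.e. the singular vertices seen in the boundary path
space. -/
def boundaryVertices : Set E.BoundaryPath :=
  {α | ∃ (v : V) (h : FinitePath.source E (.inl v) ∈ E.singularVertices), α = .fin (.inl v) h}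

/-- The finite paths with singular source, as a subset of the boundary path space. -/
def singularFinitePaths : Set E.BoundaryPath :=
  {β | ∃ (α : E.FinitePath) (h : FinitePath.source E α ∈ E.singularVertices), β = .fin α h}

/-- The infinite paths, as a subset of the boundary path space. -/
def infinitePaths : Set E.BoundaryPath := {β | ∃ p : E.InfinitePath, β = .inf p}

/-- `E.Z S` is the set of boundary paths whose range, or one of whose initial segments of
positive length, belongs to `S`. -/
def Z (S : Set E.FinitePath) : Set E.BoundaryPath :=
  {α | (.inl α.range : E.FinitePath) ∈ S ∨
    ∃ (n : ℕ) (p : E.EdgePath n), (.inr ⟨n, p⟩ : E.FinitePath) ∈ S ∧ α.HasPrefix p}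

/-- The topology of the boundary path space, generated by the sets `Z U \ Z K` with `U` open and
`K` compact in the finite path space. -/
instance : TopologicalSpace E.BoundaryPath :=
  TopologicalSpace.generateFrom
    {B | ∃ U K : Set E.FinitePath, IsOpen U ∧ IsCompact K ∧ B = E.Z U \ E.Z K}

instance : MeasurableSpace E.BoundaryPath := borel _

instance : BorelSpace E.BoundaryPath := ⟨rfl⟩

/-- The range map on the boundary path space is continuous. -/
theorem BoundaryPath.continuous_range :
    Continuous (BoundaryPath.range : E.BoundaryPath → V) := by
  refine continuous_def.2 fun U hU => TopologicalSpace.isOpen_generateFrom_of_mem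
    ⟨Sum.inl '' U, ∅, isOpenMap_inl _ hU, isCompact_empty, ?_⟩
  ext α
  simp [Z]

/-- Invariant measures on the boundary path space: regular Borel measures `ν` such that
`ν (σ A) = ν A` for each Borel set `A` of boundary paths of positive length on which the
backwards shift `σ` is injective. -/
structure IsInvariantMeasure (ν : Measure E.BoundaryPath) : Prop where
  regular : ν.Regular
  measure_shift_image : ∀ A : Set E.BoundaryPath, MeasurableSet A →
    A ⊆ E.boundaryVerticesᶜ → InjOn BoundaryPath.shift A →
    ν (BoundaryPath.shift '' A) = ν A

/-! ### The operator `T` on measures on the vertex space -/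

variable [MeasurableSpace V] [MeasurableSpace W]

/-- The pulled back measure `s^*μ` on the edge space: the integral with respect to `μ` of the
counting measures on the fibres of `s`. -/
noncomputable def pullback (μ : Measure V) : Measure W :=
  μ.bind fun v => Measure.count.restrict (E.s ⁻¹' {v})

/-- The map `T μ = r_*(s^*μ)`. -/
noncomputable def T (μ : Measure V) : Measure V := (E.pullback μ).map E.r

/-- The fibre counting measures depend measurably on the base point, so that `pullback` is given
by its intended formula. -/
theorem measurable_fiber_count [T2Space V] [SecondCountableTopology W]
    [BorelSpace V] [BorelSpace W] :
    Measurable fun v => (Measure.count : Measure W).restrict (E.s ⁻¹' {v}) := by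
  choose φ hφ hφs using E.isLocalHomeomorph_s
  obtain ⟨t, htc, ht⟩ := TopologicalSpace.countable_cover_nhds
    (f := fun x => (φ x).source) fun x => (φ x).open_source.mem_nhds (hφ x)
  have hinj : ∀ x, InjOn E.s (φ x).source := fun x => by
    rw [hφs x]; exact (φ x).injOn
  have himg : ∀ x, ∀ B : Set W, MeasurableSet B → B ⊆ (φ x).source →
      MeasurableSet (E.s '' B) := by
    intro x B hB hBx
    have hemb : IsOpenEmbedding ((φ x).source.domRestrict E.s) := by
      have h1 := (φ x).isOpenEmbedding_restrict
      rwa [← hφs x] at h1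
    have h2 := hemb.measurableEmbedding.measurableSet_image.2
      (measurable_subtype_coe hB)
    have h3 : E.s '' B = (φ x).source.domRestrict E.s '' (Subtype.val ⁻¹' B) := by
      ext v
      constructor
      · rintro ⟨e, he, rfl⟩
        exact ⟨⟨e, hBx he⟩, he, rfl⟩
      · rintro ⟨e, he, rfl⟩
        exact ⟨e, he, rfl⟩
    rw [h3]; exact h2
  have : MeasurableSingletonClass V := inferInstance
  have hsm : Measurable E.s := E.isLocalHomeomorph_s.continuous.measurable
  have : Countable t := htc.to_subtype
  rcases isEmpty_or_nonempty t with hemp | hne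
  · have : IsEmpty W := by
      refine ⟨fun e => ?_⟩
      have he : e ∈ (⋃ x ∈ t, (φ x).source) := by rw [ht]; trivial
      simp only [mem_iUnion] at he
      obtain ⟨x, hx, -⟩ := he
      exact hemp.elim ⟨x, hx⟩
    have h0 : (fun v => (Measure.count : Measure W).restrict (E.s ⁻¹' {v})) = fun _ => 0 := by
      funext v
      exact Measure.eq_zero_of_isEmpty _
    rw [h0]
    exact measurable_const
  obtain ⟨g, hg⟩ := exists_surjective_nat t
  let D : ℕ → Set W := disjointed fun n => (φ (g n)).source
  have hDm : ∀ n, MeasurableSet (D n) :=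
    MeasurableSet.disjointed fun n => (φ (g n)).open_source.measurableSet
  have hDs : ∀ n, D n ⊆ (φ (g n)).source := fun n => disjointed_subset _ n
  have hDu : ⋃ n, D n = univ := by
    rw [iUnion_disjointed, eq_univ_iff_forall]
    intro e
    have he : e ∈ (⋃ x ∈ t, (φ x).source) := by rw [ht]; trivial
    simp only [mem_iUnion] at he ⊢
    obtain ⟨x, hx, hex⟩ := he
    obtain ⟨n, hn⟩ := hg ⟨x, hx⟩
    exact ⟨n, by rw [hn]; exact hex⟩
  refine Measure.measurable_of_measurable_coe _ fun A hA => ?_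
  have key : ∀ v, (Measure.count : Measure W).restrict (E.s ⁻¹' {v}) A =
      ∑' n, (E.s '' (A ∩ D n)).indicator (fun _ => (1 : ENNReal)) v := by
    intro v
    have hv : MeasurableSet (E.s ⁻¹' {v}) := hsm (measurableSet_singleton v)
    have hA' : A ∩ E.s ⁻¹' {v} = ⋃ n, (A ∩ D n) ∩ E.s ⁻¹' {v} := by
      rw [← iUnion_inter, ← inter_iUnion, hDu, inter_univ]
    rw [Measure.restrict_apply hA, hA', measure_iUnion
      (fun i j hij => ((disjoint_disjointed _) hij).mono
        (fun x hx => hx.1.2) (fun x hx => hx.1.2))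
      (fun n => (hA.inter (hDm n)).inter hv)]
    refine tsum_congr fun n => ?_
    rw [Measure.count_apply ((hA.inter (hDm n)).inter hv)]
    by_cases hmem : v ∈ E.s '' (A ∩ D n)
    · rw [indicator_of_mem hmem]
      obtain ⟨e, he, rfl⟩ := hmem
      have : (A ∩ D n) ∩ E.s ⁻¹' {E.s e} = {e} := by
        ext e'
        simp only [mem_inter_iff, mem_preimage, mem_singleton_iff]
        constructor
        · rintro ⟨⟨-, h1⟩, h2⟩
          exact hinj (g n) (hDs n h1) (hDs n he.2) h2
        · rintro rfl
          exact ⟨he, rfl⟩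
      rw [this]; simp
    · rw [indicator_of_notMem hmem]
      have : (A ∩ D n) ∩ E.s ⁻¹' {v} = ∅ := by
        ext e'
        simp only [mem_inter_iff, mem_preimage, mem_singleton_iff, mem_empty_iff_false, iff_false]
        rintro ⟨h1, h2⟩
        exact hmem ⟨e', h1, h2⟩
      rw [this]; simp
  simp_rw [key]
  exact Measurable.tsum fun n => measurable_const.indicator
    (himg (g n) _ (hA.inter (hDm n)) (inter_subset_right.trans (hDs n)))

/-- The defining property of `s^*μ`, for all measurable `h ≥ 0`. -/
theorem lintegral_pullback [T2Space V] [SecondCountableTopology W]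
    [BorelSpace V] [T2Space W] [BorelSpace W] (μ : Measure V) {h : W → ENNReal}
    (hh : Measurable h) :
    ∫⁻ e, h e ∂(E.pullback μ) = ∫⁻ v, ∑' e : E.s ⁻¹' {v}, h e ∂μ := by
  have hsm : Measurable E.s := E.isLocalHomeomorph_s.continuous.measurable
  rw [pullback, Measure.lintegral_bind E.measurable_fiber_count.aemeasurable hh.aemeasurable]
  refine lintegral_congr fun v => ?_
  rw [← lintegral_indicator (hsm (measurableSet_singleton v)), lintegral_count, tsum_subtype]

end TopologicalGraph

namespace TopologicalGraph

/-! ### Boundary paths described by their range and their edges -/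

section Paths

variable {V : Type u} {W : Type v} [TopologicalSpace V] [TopologicalSpace W]
  {E : TopologicalGraph V W}

namespace BoundaryPath

/-! Let `ν_n` be the image under the range map of `ν` restricted to the paths of length at least `n`
(`rangeMeasure ν n`), so that `ν_0 = μ`. Everything follows from `T^n μ = ν_n`
(`iterate_T_map_range`). If `s` is injective on `C`, the shift maps the paths of length at least `n
+ 1` with first edge in `C` bijectively onto the paths of length at least `n` with range in `s(C)`.
Invariance therefore identifies `s^*ν_n` with the distribution of the first edge of paths of length
at least `n + 1` (`pullback_rangeMeasure_apply`), and applying `r` gives `T ν_n = ν_{n+1}`.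

The range map on `∂E` is proper (`isCompact_preimage_range`), so `ν` is finite on `r⁻¹(K)` for
compact `K`. This makes each `ν_n` regular and, by continuity from above, `ν_n(K)` decreases to
`ν(r⁻¹(K) ∩ E^∞)`. Hence `ν_n → 0` against `C_c` functions exactly when `E^∞` is null. If `Tμ = μ`,
then `ν_n(K) = ν_0(K) < ∞`, so almost every path has length at least `n`, for all `n`; the converse
is immediate. -/

theorem range_eq_of_edge?_zero {α : E.BoundaryPath} {e : W} (h : α.edge? 0 = some e) :
    α.range = E.r e := by
  rcases α with ⟨v | ⟨n, p⟩, hs⟩ | p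
  · simp [edge?] at h
  · simp only [edge?, Nat.zero_lt_succ, dif_pos, Option.some.injEq] at h
    rw [← h]; rfl
  · simp only [edge?, Option.some.injEq] at h
    rw [← h]; rfl

theorem source_eq_range_of_edge? {α : E.BoundaryPath} {i : ℕ} {e f : W}
    (he : α.edge? i = some e) (hf : α.edge? (i + 1) = some f) : E.s e = E.r f := by
  rcases α with ⟨v | ⟨n, p⟩, hs⟩ | p
  · simp [edge?] at he
  · simp only [edge?, Option.dite_none_right_eq_some, Option.some.injEq] at he hf
    obtain ⟨h1, rfl⟩ := he
    obtain ⟨h2, rfl⟩ := hf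
    exact p.2 ⟨i, by omega⟩
  · simp only [edge?, Option.some.injEq] at he hf
    rw [← he, ← hf]
    exact p.2 i

theorem exists_edge?_of_le {α : E.BoundaryPath} {i j : ℕ} (hij : i ≤ j) {e : W}
    (he : α.edge? j = some e) : ∃ f, α.edge? i = some f := by
  rcases α with ⟨v | ⟨n, p⟩, hs⟩ | p
  · simp [edge?] at he
  · simp only [edge?, Option.dite_none_right_eq_some, Option.some.injEq] at he
    obtain ⟨h1, rfl⟩ := he
    exact ⟨p.1 ⟨i, by omega⟩, by simp only [edge?]; rw [dif_pos (by omega)]⟩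
  · exact ⟨p.1 i, rfl⟩

theorem singular_of_edge?_zero_eq_none {α : E.BoundaryPath} (h : α.edge? 0 = none) :
    α.range ∈ E.singularVertices := by
  rcases α with ⟨v | ⟨n, p⟩, hs⟩ | p
  · exact hs
  · simp [edge?] at h
  · simp [edge?] at h

theorem singular_of_edge?_succ_eq_none {α : E.BoundaryPath} {i : ℕ} {e : W}
    (he : α.edge? i = some e) (h : α.edge? (i + 1) = none) : E.s e ∈ E.singularVertices := by
  rcases α with ⟨v | ⟨n, p⟩, hs⟩ | p
  · simp [edge?] at he
  · simp only [edge?, Option.dite_none_right_eq_some, Option.some.injEq] at he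
    obtain ⟨h1, rfl⟩ := he
    have h2 : ¬ i + 1 < n + 1 := by
      intro h2
      simp only [edge?] at h
      rw [dif_pos h2] at h
      exact absurd h (by simp)
    obtain rfl : i = n := by omega
    exact hs
  · simp [edge?] at h

/-- The edges alone determine a path of positive length; the ranges are needed to separate paths of
length `0`, which have no edges. -/
theorem ext_edge? {α β : E.BoundaryPath} (hr : α.range = β.range)
    (he : ∀ i, α.edge? i = β.edge? i) : α = β := by
  rcases α with ⟨v | ⟨n, p⟩, hs⟩ | p <;> rcases β with ⟨w | ⟨m, q⟩, ht⟩ | q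
  · obtain rfl : v = w := hr
    rfl
  · simpa [edge?] using he 0
  · simpa [edge?] using he 0
  · simpa [edge?] using he 0
  · have hnm : n = m := by
      have h1 := he m
      have h2 := he n
      simp only [edge?, Nat.lt_succ_self, dif_pos] at h1 h2
      have h3 : m < n + 1 := by
        by_contra h3
        rw [dif_neg h3] at h1
        exact absurd h1 (by simp)
      have h4 : n < m + 1 := by
        by_contra h4
        rw [dif_neg h4] at h2
        exact absurd h2 (by simp)
      omega
    subst hnm
    have hpq : p = q := by
      ext i
      have := he i
      simp only [edge?] at this
      rw [dif_pos i.2, dif_pos i.2] at this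
      exact Option.some.inj this
    subst hpq
    rfl
  · have := he (n + 1)
    simp [edge?] at this
  · simpa [edge?] using he 0
  · have := he (m + 1)
    simp [edge?] at this
  · have hpq : p = q := by
      ext i
      exact Option.some.inj (he i)
    subst hpq
    rfl

theorem exists_hasPrefix {α : E.BoundaryPath} {n : ℕ} (h : ∃ e, α.edge? n = some e) :
    ∃ p : E.EdgePath n, α.HasPrefix p := by
  obtain ⟨e, he⟩ := h
  choose f hf using fun i : Fin (n + 1) =>
    exists_edge?_of_le (α := α) (Nat.le_of_lt_succ i.2) he
  exact ⟨⟨f, fun i => source_eq_range_of_edge? (hf i.castSucc) (hf i.succ)⟩, hf⟩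

/-- Prepending an edge does not change the source, so singularity is inherited. This gives
surjectivity of the shift onto the paths with range `s(e)`. -/
theorem exists_cons {e : W} {β : E.BoundaryPath} (h : E.s e = β.range) :
    ∃ α : E.BoundaryPath, α.edge? 0 = some e ∧ ∀ i, α.edge? (i + 1) = β.edge? i := by
  rcases β with ⟨v | ⟨n, p⟩, hs⟩ | p
  · refine ⟨.fin (.inr ⟨0, fun _ => e, fun i => i.elim0⟩) ?_, rfl, fun i => ?_⟩
    · change E.s e ∈ _
      rw [h]; exact hs
    · simp [edge?]
  · refine ⟨.fin (.inr ⟨n + 1, Fin.cons e p.1, fun i => ?_⟩) ?_, rfl, fun i => ?_⟩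
    · refine Fin.cases ?_ (fun j => ?_) i
      · exact h
      · exact p.2 j
    · exact hs
    · simp only [edge?, Nat.add_lt_add_iff_right]
      rfl
  · refine ⟨.inf ⟨fun i => Nat.casesOn i e p.1, fun i => ?_⟩, rfl, fun i => rfl⟩
    cases i with
    | zero => exact h
    | succ j => exact p.2 j

theorem edge?_shift {α : E.BoundaryPath} (h : α ∉ E.boundaryVertices) (i : ℕ) :
    α.shift.edge? i = α.edge? (i + 1) := by
  rcases α with ⟨v | ⟨_ | n, p⟩, hs⟩ | p
  · exact absurd ⟨v, hs, rfl⟩ h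
  · simp [edge?, shift, FinitePath.shift]
  · simp only [edge?, shift, FinitePath.shift, Nat.add_lt_add_iff_right]
    rfl
  · rfl

theorem range_shift {α : E.BoundaryPath} {e : W} (h : α.edge? 0 = some e) :
    α.shift.range = E.s e := by
  rcases α with ⟨v | ⟨_ | n, p⟩, hs⟩ | p
  · simp [edge?] at h
  · simp only [edge?, Nat.zero_lt_succ, dif_pos, Option.some.injEq] at h
    rw [← h]; rfl
  · simp only [edge?, Nat.zero_lt_succ, dif_pos, Option.some.injEq] at h
    rw [← h]; exact (p.2 0).symm
  · simp only [edge?, Option.some.injEq] at h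
    rw [← h]; exact (p.2 0).symm

theorem notMem_boundaryVertices {α : E.BoundaryPath} {e : W} (h : α.edge? 0 = some e) :
    α ∉ E.boundaryVertices := by
  rintro ⟨v, hs, rfl⟩
  simp [edge?] at h

end BoundaryPath

end Paths

/-! ### Properness of the range map, by ultrafilters -/

section Compactness

variable {V : Type u} {W : Type v} [TopologicalSpace V] [TopologicalSpace W]
  {E : TopologicalGraph V W}

namespace BoundaryPath

/-- Along the filter `F`, the edge with index `i` eventually exists and converges to `w`. -/
def EdgeTendsto (F : Filter E.BoundaryPath) (i : ℕ) (w : W) : Prop :=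
  ∀ U ∈ 𝓝 w, ∀ᶠ α in F, ∃ e ∈ U, α.edge? i = some e

theorem EdgeTendsto.exists_tendsto {F : Filter E.BoundaryPath} {i : ℕ} {w : W}
    (h : EdgeTendsto F i w) :
    ∃ g : E.BoundaryPath → W, (∀ᶠ α in F, α.edge? i = some (g α)) ∧ Tendsto g F (𝓝 w) := by
  -- The default value `w` is irrelevant: the edge exists eventually along `F`.
  refine ⟨fun α => (α.edge? i).getD w, ?_, fun U hU => ?_⟩
  · filter_upwards [h univ univ_mem] with α hα
    obtain ⟨e, -, he⟩ := hα
    simp [he]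
  · rw [mem_map]
    filter_upwards [h U hU] with α hα
    obtain ⟨e, he, h3⟩ := hα
    rw [mem_preimage, h3]
    exact he

theorem EdgeTendsto.unique [T2Space W] {F : Filter E.BoundaryPath} [F.NeBot] {i : ℕ} {w w' : W}
    (h : EdgeTendsto F i w) (h' : EdgeTendsto F i w') : w = w' := by
  obtain ⟨g, hg, hgw⟩ := h.exists_tendsto
  obtain ⟨g', hg', hgw'⟩ := h'.exists_tendsto
  refine tendsto_nhds_unique_of_eventuallyEq hgw hgw' ?_
  filter_upwards [hg, hg'] with α h1 h2
  exact Option.some.inj (h1.symm.trans h2)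

theorem EdgeTendsto.source_eq_range [T2Space V] {F : Filter E.BoundaryPath} [F.NeBot] {i : ℕ}
    {w w' : W} (h : EdgeTendsto F i w) (h' : EdgeTendsto F (i + 1) w') : E.s w = E.r w' := by
  obtain ⟨g, hg, hgw⟩ := h.exists_tendsto
  obtain ⟨g', hg', hgw'⟩ := h'.exists_tendsto
  refine tendsto_nhds_unique_of_eventuallyEq
    ((E.isLocalHomeomorph_s.continuous.tendsto w).comp hgw)
    ((E.continuous_r.tendsto w').comp hgw') ?_
  filter_upwards [hg, hg'] with α h1 h2
  exact source_eq_range_of_edge? h1 h2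

theorem EdgeTendsto.range_eq [T2Space V] {F : Filter E.BoundaryPath} [F.NeBot] {w : W} {v : V}
    (h : EdgeTendsto F 0 w) (hv : Tendsto range F (𝓝 v)) : E.r w = v := by
  obtain ⟨g, hg, hgw⟩ := h.exists_tendsto
  refine tendsto_nhds_unique_of_eventuallyEq ((E.continuous_r.tendsto w).comp hgw) hv ?_
  filter_upwards [hg] with α h1
  exact (range_eq_of_edge?_zero h1).symm

theorem exists_edgeTendsto_of_isCompact {F : Ultrafilter E.BoundaryPath} {i : ℕ} {C : Set W}
    (hC : IsCompact C) (h : ∀ᶠ α in (F : Filter E.BoundaryPath), ∃ e ∈ C, α.edge? i = some e) :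
    ∃ w, EdgeTendsto (F : Filter E.BoundaryPath) i w := by
  obtain ⟨α₀, e₀, -⟩ := h.exists
  have : Nonempty W := ⟨e₀⟩
  obtain ⟨g, hg⟩ := h.choice
  obtain ⟨w, -, hw⟩ := hC.ultrafilter_le_nhds (F.map g)
    (le_principal_iff.2 (hg.mono fun α hα => hα.1))
  refine ⟨w, fun U hU => ?_⟩
  have hgU : ∀ᶠ α in (F : Filter E.BoundaryPath), g α ∈ U := hw hU
  filter_upwards [hg, hgU] with α h1 h2
  exact ⟨g α, h2, h1.2⟩

/-- The source of a limit of initial segments is singular if the next edges do not converge. -/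
theorem singular_of_not_edgeTendsto {F : Ultrafilter E.BoundaryPath} {N : ℕ}
    (hN : ¬ ∃ w, EdgeTendsto (F : Filter E.BoundaryPath) N w) {h : E.BoundaryPath → V} {x : V}
    (hx : Tendsto h F (𝓝 x))
    (hnone : ∀ᶠ α in (F : Filter E.BoundaryPath),
      α.edge? N = none → h α ∈ E.singularVertices)
    (hsome : ∀ᶠ α in (F : Filter E.BoundaryPath), ∀ e, α.edge? N = some e → E.r e = h α) :
    x ∈ E.singularVertices := by
  -- A neighbourhood `U` witnessing regularity of `x` does so for all its points. Eventually `h α ∈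
  -- U`, so `α` cannot stop there, and its next edge lies in the compact set `r⁻¹(closure U)`; such
  -- edges converge along an ultrafilter, contrary to `hN`.
  intro hreg
  obtain ⟨U, hU, hxU, hc, hrc, him⟩ := hreg
  refine hN (exists_edgeTendsto_of_isCompact hrc ?_)
  filter_upwards [hnone, hsome, hx (hU.mem_nhds hxU)] with α h1 h2 h3
  rcases he : α.edge? N with _ | e
  · exact absurd ⟨U, hU, h3, hc, hrc, him⟩ (h1 he)
  · refine ⟨e, subset_closure ?_, rfl⟩
    rw [h2 e he]
    exact h3

/-- `α` has the finite path `x` as an initial segment. -/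
def HasInit (α : E.BoundaryPath) (x : E.FinitePath) : Prop :=
  x = .inl α.range ∨ ∃ (n : ℕ) (p : E.EdgePath n), x = .inr ⟨n, p⟩ ∧ α.HasPrefix p

theorem mem_Z_iff {α : E.BoundaryPath} {S : Set E.FinitePath} :
    α ∈ E.Z S ↔ ∃ x ∈ S, α.HasInit x := by
  constructor
  · rintro (h | ⟨n, p, h, hp⟩)
    · exact ⟨_, h, .inl rfl⟩
    · exact ⟨_, h, .inr ⟨n, p, rfl, hp⟩⟩
  · rintro ⟨x, hx, rfl | ⟨n, p, rfl, hp⟩⟩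
    · exact .inl hx
    · exact .inr ⟨n, p, hx, hp⟩

/-- Edgewise convergence implies convergence. -/
theorem le_nhds_of_edgeTendsto [T2Space V] [T2Space W] {F : Ultrafilter E.BoundaryPath}
    {β : E.BoundaryPath} (hr : Tendsto range (F : Filter E.BoundaryPath) (𝓝 β.range))
    (hsome : ∀ i w, β.edge? i = some w → EdgeTendsto (F : Filter E.BoundaryPath) i w)
    (hnone : ∀ i, β.edge? i = none →
      ∃ j ≤ i, ¬ ∃ w, EdgeTendsto (F : Filter E.BoundaryPath) j w) :
    (F : Filter E.BoundaryPath) ≤ 𝓝 β := by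
  refine (TopologicalSpace.tendsto_nhds_generateFrom_iff (m := id)).2 ?_
  rintro _ ⟨U, K, hU, hK, rfl⟩ ⟨hβU, hβK⟩
  rw [preimage_id]
  refine inter_mem ?_ (Ultrafilter.compl_mem_iff_notMem.2 fun hZK => hβK ?_)
  · obtain ⟨x, hx, rfl | ⟨n, p, rfl, hp⟩⟩ := mem_Z_iff.1 hβU
    · filter_upwards [hr ((hU.preimage continuous_inl).mem_nhds hx)] with α hα
      exact .inl hα
    · have hlim : ∀ i : Fin (n + 1), EdgeTendsto (F : Filter E.BoundaryPath) i (p.1 i) :=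
        fun i => hsome i _ (hp i)
      have : Nonempty (E.EdgePath n) := ⟨p⟩
      have hex : ∀ᶠ α in (F : Filter E.BoundaryPath), ∃ q : E.EdgePath n, α.HasPrefix q := by
        filter_upwards [hlim (Fin.last n) univ univ_mem] with α hα
        obtain ⟨e, -, he⟩ := hα
        exact exists_hasPrefix ⟨e, he⟩
      obtain ⟨g, hg⟩ := hex.choice
      have hgp : Tendsto g (F : Filter E.BoundaryPath) (𝓝 p) := by
        refine tendsto_subtype_rng.2 (tendsto_pi_nhds.2 fun i => ?_)
        obtain ⟨f, hf, hfi⟩ := (hlim i).exists_tendsto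
        refine hfi.congr' ?_
        filter_upwards [hf, hg] with α h1 h2
        exact Option.some.inj (h1.symm.trans (h2 i))
      have hc : Continuous fun q : E.EdgePath n => (Sum.inr ⟨n, q⟩ : E.FinitePath) :=
        continuous_inr.comp continuous_sigmaMk
      filter_upwards [hg, hgp ((hU.preimage hc).mem_nhds hx)] with α h1 h2
      exact .inr ⟨n, g α, h2, h1⟩
  · have hex : ∀ᶠ α in (F : Filter E.BoundaryPath), ∃ x ∈ K, α.HasInit x := by
      filter_upwards [hZK] with α hα
      exact mem_Z_iff.1 hα
    have : Nonempty E.FinitePath := ⟨.inl β.range⟩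
    obtain ⟨g, hg⟩ := hex.choice
    obtain ⟨k, hkK, hk⟩ := hK.ultrafilter_le_nhds (F.map g)
      (le_principal_iff.2 (hg.mono fun α hα => hα.1))
    -- The chosen initial segments converge to some `k ∈ K`. Each length gives an open piece of the
    -- finite path space, so they eventually have the length of `k`, and `k` turns out to be an
    -- initial segment of `β`.
    refine mem_Z_iff.2 ⟨k, hkK, ?_⟩
    rcases k with v | ⟨n, p⟩
    · left
      congr 1
      refine tendsto_nhds_unique (f := range) (fun O hO => ?_) hr
      have h1 : Sum.inl '' O ∈ 𝓝 (Sum.inl v : E.FinitePath) :=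
        IsOpenEmbedding.inl.image_mem_nhds.2 hO
      have h2 : ∀ᶠ α in (F : Filter E.BoundaryPath), g α ∈ Sum.inl '' O := hk h1
      rw [mem_map]
      filter_upwards [hg, h2] with α h3 h4
      obtain ⟨o, ho, h5⟩ := h4
      rcases h3.2 with h6 | ⟨n, p, h6, -⟩
      · rw [← h5] at h6
        rw [mem_preimage, ← Sum.inl.inj h6]
        exact ho
      · rw [← h5] at h6
        exact absurd h6 (by simp)
    · right
      have hlim : ∀ i : Fin (n + 1), EdgeTendsto (F : Filter E.BoundaryPath) i (p.1 i) := by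
        intro i O hO
        have hc : Continuous fun q : E.EdgePath n => q.1 i :=
          (continuous_apply i).comp continuous_subtype_val
        have h1 : (fun q : E.EdgePath n => (Sum.inr ⟨n, q⟩ : E.FinitePath)) ''
            {q | q.1 i ∈ O} ∈ 𝓝 (Sum.inr ⟨n, p⟩ : E.FinitePath) :=
          (IsOpenEmbedding.inr.comp IsOpenEmbedding.sigmaMk).image_mem_nhds.2
            (hc.continuousAt hO)
        have h2 : ∀ᶠ α in (F : Filter E.BoundaryPath), g α ∈
            (fun q : E.EdgePath n => (Sum.inr ⟨n, q⟩ : E.FinitePath)) '' {q | q.1 i ∈ O} := hk h1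
        filter_upwards [hg, h2] with α h3 h4
        obtain ⟨q, hq, h5⟩ := h4
        rcases h3.2 with h6 | ⟨m, p', h6, h7⟩
        · rw [← h5] at h6
          exact absurd h6 (by simp)
        · rw [← h5] at h6
          cases h6
          exact ⟨_, hq, h7 i⟩
      refine ⟨n, p, rfl, fun i => ?_⟩
      rcases hβ : β.edge? i with _ | e
      -- `β` is not shorter than `k`: all edges of the segments up to index `i` converge.
      · obtain ⟨j, hji, hj⟩ := hnone i hβ
        exact absurd ⟨_, hlim ⟨j, by omega⟩⟩ hj
      · rw [(hsome i e hβ).unique (hlim i)]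

/-- The range map of the boundary path space is proper. -/
theorem isCompact_preimage_range [T2Space V] [T2Space W] {K : Set V} (hK : IsCompact K) :
    IsCompact (range ⁻¹' K : Set E.BoundaryPath) := by
  refine isCompact_iff_ultrafilter_le_nhds.2 fun F hF => ?_
  obtain ⟨v, hvK, hv⟩ := hK.ultrafilter_le_nhds (F.map range)
    (le_principal_iff.2 (show range ⁻¹' K ∈ F from le_principal_iff.1 hF))
  have hv' : Tendsto range (F : Filter E.BoundaryPath) (𝓝 v) := hv
  suffices h : ∃ β : E.BoundaryPath, β.range = v ∧
      (∀ i w, β.edge? i = some w → EdgeTendsto (F : Filter E.BoundaryPath) i w) ∧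
      ∀ i, β.edge? i = none → ∃ j ≤ i, ¬ ∃ w, EdgeTendsto (F : Filter E.BoundaryPath) j w by
    obtain ⟨β, rfl, h1, h2⟩ := h
    exact ⟨β, hvK, le_nhds_of_edgeTendsto hv' h1 h2⟩
  -- The limit consists of the limit edges up to the first index `N` without one. If there is such
  -- an `N`, the path ends there, and its source is singular by `singular_of_not_edgeTendsto`.
  by_cases hall : ∀ i, ∃ w, EdgeTendsto (F : Filter E.BoundaryPath) i w
  · choose w hw using hall
    refine ⟨.inf ⟨w, fun i => (hw i).source_eq_range (hw (i + 1))⟩, (hw 0).range_eq hv',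
      fun i w' h => ?_, fun i h => ?_⟩
    · obtain rfl : w i = w' := Option.some.inj h
      exact hw i
    · simp [edge?] at h
  · classical
    rw [not_forall] at hall
    have hlt : ∀ i < Nat.find hall, ∃ w, EdgeTendsto (F : Filter E.BoundaryPath) i w :=
      fun i hi => not_not.1 (Nat.find_min hall hi)
    have hfind := Nat.find_spec hall
    generalize Nat.find hall = N at hlt hfind
    rcases N with _ | n
    · refine ⟨.fin (.inl v) (singular_of_not_edgeTendsto hfind hv' ?_ ?_), rfl,
        fun i w h => by simp [edge?] at h, fun i _ => ⟨0, Nat.zero_le i, hfind⟩⟩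
      · exact .of_forall fun α => singular_of_edge?_zero_eq_none
      · exact .of_forall fun α e he => (range_eq_of_edge?_zero he).symm
    · choose w hw using fun i : Fin (n + 1) => hlt i i.2
      obtain ⟨g, hg, hgw⟩ := (hw (Fin.last n)).exists_tendsto
      refine ⟨.fin (.inr ⟨n, w, fun i => (hw i.castSucc).source_eq_range (hw i.succ)⟩)
        (singular_of_not_edgeTendsto hfind
          ((E.isLocalHomeomorph_s.continuous.tendsto _).comp hgw) ?_ ?_),
        (hw 0).range_eq hv', fun i w' h => ?_, fun i h => ⟨n + 1, ?_, hfind⟩⟩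
      · filter_upwards [hg] with α hα
        exact singular_of_edge?_succ_eq_none hα
      · filter_upwards [hg] with α hα e he
        exact (source_eq_range_of_edge? hα he).symm
      · simp only [edge?, Option.dite_none_right_eq_some, Option.some.injEq] at h
        obtain ⟨hi, rfl⟩ := h
        exact hw ⟨i, hi⟩
      · by_contra hi
        simp only [edge?] at h
        rw [dif_pos (by omega)] at h
        exact absurd h (by simp)

end BoundaryPath

end Compactness

/-! ### Cylinder sets, path lengths and the shift -/

section Measures

variable {V : Type u} {W : Type v} [TopologicalSpace V] [TopologicalSpace W]
  (E : TopologicalGraph V W)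

/-- The boundary paths whose edge with index `i` exists and lies in `C`. -/
def edgeCylinder (i : ℕ) (C : Set W) : Set E.BoundaryPath :=
  {α | ∃ e ∈ C, α.edge? i = some e}

/-- The boundary paths of length at least `n`. -/
def pathsOfLengthGE (n : ℕ) : Set E.BoundaryPath :=
  {α | ∀ i < n, ∃ e, α.edge? i = some e}

variable {E}

theorem isOpen_edgeCylinder (i : ℕ) {C : Set W} (hC : IsOpen C) :
    IsOpen (E.edgeCylinder i C) := by
  have hc : Continuous fun p : E.EdgePath i => p.1 (Fin.last i) :=
    (continuous_apply _).comp continuous_subtype_val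
  refine TopologicalSpace.isOpen_generateFrom_of_mem
    ⟨(fun p : E.EdgePath i => (Sum.inr ⟨i, p⟩ : E.FinitePath)) '' {p | p.1 (Fin.last i) ∈ C}, ∅,
      (IsOpenEmbedding.inr.comp IsOpenEmbedding.sigmaMk).isOpenMap _ (hC.preimage hc),
      isCompact_empty, ?_⟩
  ext α
  constructor
  · rintro ⟨e, heC, he⟩
    obtain ⟨p, hp⟩ := BoundaryPath.exists_hasPrefix ⟨e, he⟩
    have hpe : p.1 (Fin.last i) = e := Option.some.inj ((hp (Fin.last i)).symm.trans he)
    refine ⟨.inr ⟨i, p, ⟨p, ?_, rfl⟩, hp⟩, by simp [Z]⟩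
    rw [mem_ofPred_eq, hpe]
    exact heC
  · rintro ⟨⟨p, -, h⟩ | ⟨n, p, ⟨q, hq, h⟩, hp⟩, -⟩
    · exact absurd h (by simp)
    · cases h
      exact ⟨_, hq, hp (Fin.last i)⟩

theorem measurableSet_edgeCylinder [MeasurableSpace W] [BorelSpace W] (i : ℕ) {C : Set W}
    (hC : MeasurableSet C) : MeasurableSet (E.edgeCylinder i C) := by
  induction C, hC using MeasurableSet.induction_on_open with
  | isOpen U hU => exact (isOpen_edgeCylinder i hU).measurableSet
  | compl t ht ih =>
    -- The complement is relative to the paths that have an edge with index `i`.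
    have h : E.edgeCylinder i tᶜ = E.edgeCylinder i univ \ E.edgeCylinder i t := by
      ext α
      constructor
      · rintro ⟨e, he, h⟩
        refine ⟨⟨e, trivial, h⟩, ?_⟩
        rintro ⟨f, hf, h'⟩
        rw [h, Option.some.injEq] at h'
        exact he (h' ▸ hf)
      · rintro ⟨⟨e, -, h⟩, h'⟩
        exact ⟨e, fun he => h' ⟨e, he, h⟩, h⟩
    rw [h]
    exact (isOpen_edgeCylinder i isOpen_univ).measurableSet.diff ih
  | iUnion f _ _ ih =>
    have h : E.edgeCylinder i (⋃ n, f n) = ⋃ n, E.edgeCylinder i (f n) := by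
      ext α
      simp only [edgeCylinder, mem_iUnion, mem_ofPred_eq]
      constructor
      · rintro ⟨e, ⟨n, hn⟩, h⟩
        exact ⟨n, e, hn, h⟩
      · rintro ⟨n, e, hn, h⟩
        exact ⟨e, ⟨n, hn⟩, h⟩
    rw [h]
    exact .iUnion ih

theorem pathsOfLengthGE_zero : E.pathsOfLengthGE 0 = univ := by
  simp [pathsOfLengthGE]

theorem antitone_pathsOfLengthGE : Antitone E.pathsOfLengthGE :=
  fun _ _ hmn _ hα i hi => hα i (hi.trans_le hmn)

theorem measurableSet_pathsOfLengthGE (n : ℕ) : MeasurableSet (E.pathsOfLengthGE n) := by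
  have h : E.pathsOfLengthGE n = ⋂ i, ⋂ (_ : i < n), E.edgeCylinder i univ := by
    ext α
    simp [pathsOfLengthGE, edgeCylinder]
  rw [h]
  exact .iInter fun i => .iInter fun _ => (isOpen_edgeCylinder i isOpen_univ).measurableSet

theorem iInter_pathsOfLengthGE : ⋂ n, E.pathsOfLengthGE n = E.infinitePaths := by
  ext α
  rw [mem_iInter]
  constructor
  · intro h
    rcases α with ⟨v | ⟨n, p⟩, hs⟩ | p
    · obtain ⟨e, he⟩ := h 1 0 one_pos
      simp [BoundaryPath.edge?] at he
    · obtain ⟨e, he⟩ := h (n + 2) (n + 1) (by omega)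
      simp [BoundaryPath.edge?] at he
    · exact ⟨p, rfl⟩
  · rintro ⟨p, rfl⟩ n i -
    exact ⟨p.1 i, rfl⟩

theorem compl_singularFinitePaths : E.singularFinitePathsᶜ = E.infinitePaths := by
  ext α
  rcases α with ⟨x, hs⟩ | p
  · exact ⟨fun h => absurd ⟨x, hs, rfl⟩ h, by rintro ⟨q, hq⟩; cases hq⟩
  · refine ⟨fun _ => ⟨p, rfl⟩, ?_⟩
    rintro _ ⟨q, hq, h⟩
    cases h

/-- The deleted edge is recovered from the range of the shifted path, which is its source. -/
theorem injOn_shift_edgeCylinder {C : Set W} (hC : InjOn E.s C) :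
    InjOn BoundaryPath.shift (E.edgeCylinder 0 C) := by
  rintro α ⟨e, heC, he⟩ β ⟨f, hfC, hf⟩ h
  have hef : e = f := hC heC hfC (by
    rw [← BoundaryPath.range_shift he, ← BoundaryPath.range_shift hf, h])
  subst hef
  refine BoundaryPath.ext_edge? ?_ fun i => ?_
  · rw [BoundaryPath.range_eq_of_edge?_zero he, BoundaryPath.range_eq_of_edge?_zero hf]
  · rcases i with _ | i
    · rw [he, hf]
    · rw [← BoundaryPath.edge?_shift (BoundaryPath.notMem_boundaryVertices he), h,
        BoundaryPath.edge?_shift (BoundaryPath.notMem_boundaryVertices hf)]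

theorem shift_image_edgeCylinder_inter (C : Set W) (n : ℕ) :
    BoundaryPath.shift '' (E.edgeCylinder 0 C ∩ E.pathsOfLengthGE (n + 1)) =
      BoundaryPath.range ⁻¹' (E.s '' C) ∩ E.pathsOfLengthGE n := by
  ext β
  constructor
  · rintro ⟨α, ⟨⟨e, heC, he⟩, hα⟩, rfl⟩
    refine ⟨⟨e, heC, (BoundaryPath.range_shift he).symm⟩, fun i hi => ?_⟩
    rw [BoundaryPath.edge?_shift (BoundaryPath.notMem_boundaryVertices he)]
    exact hα (i + 1) (by omega)
  · rintro ⟨⟨e, heC, he⟩, hβ⟩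
    obtain ⟨α, h0, hα⟩ := BoundaryPath.exists_cons he
    refine ⟨α, ⟨⟨e, heC, h0⟩, fun i hi => ?_⟩, BoundaryPath.ext_edge? ?_ fun i => ?_⟩
    · rcases i with _ | i
      · exact ⟨e, h0⟩
      · rw [hα]
        exact hβ i (by omega)
    · rw [BoundaryPath.range_shift h0, he]
    · rw [BoundaryPath.edge?_shift (BoundaryPath.notMem_boundaryVertices h0), hα]

theorem IsInvariantMeasure.measure_preimage_range_lt_top [T2Space V] [T2Space W]
    {ν : Measure E.BoundaryPath} (hν : E.IsInvariantMeasure ν) {K : Set V} (hK : IsCompact K) :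
    ν (BoundaryPath.range ⁻¹' K) < ⊤ := by
  have := hν.regular
  exact (BoundaryPath.isCompact_preimage_range hK).measure_lt_top

/-- `V` is σ-compact. This reduces null-set claims to the sets `r⁻¹(K)`, where `ν` is finite. -/
theorem measure_eq_zero_of_forall_preimage_range [LocallyCompactSpace V]
    [SecondCountableTopology V] {ν : Measure E.BoundaryPath} {A : Set E.BoundaryPath}
    (h : ∀ K : Set V, IsCompact K → ν (BoundaryPath.range ⁻¹' K ∩ A) = 0) : ν A = 0 := by
  have hA : A = ⋃ k, BoundaryPath.range ⁻¹' (compactCovering V k) ∩ A := by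
    rw [← iUnion_inter, ← preimage_iUnion, iUnion_compactCovering, preimage_univ, univ_inter]
  rw [hA]
  exact measure_iUnion_null fun k => h _ (isCompact_compactCovering V k)

variable (E) in
/-- The edge space has a countable cover by open sets on which the source map is injective and
preserves measurability. -/
theorem exists_countable_cover_injOn_source [MeasurableSpace V] [MeasurableSpace W]
    [SecondCountableTopology W] [BorelSpace V] [BorelSpace W] :
    ∃ S : Set (Set W), S.Countable ∧ ⋃ D ∈ S, D = univ ∧ ∀ D ∈ S, IsOpen D ∧ InjOn E.s D ∧
      ∀ B ⊆ D, MeasurableSet B → MeasurableSet (E.s '' B) := by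
  choose φ hφ hφs using E.isLocalHomeomorph_s
  obtain ⟨t, htc, ht⟩ := TopologicalSpace.countable_cover_nhds
    (f := fun x => (φ x).source) fun x => (φ x).open_source.mem_nhds (hφ x)
  refine ⟨(fun x => (φ x).source) '' t, htc.image _, by rwa [biUnion_image], ?_⟩
  rintro _ ⟨x, -, rfl⟩
  refine ⟨(φ x).open_source, by rw [hφs x]; exact (φ x).injOn, fun B hBx hB => ?_⟩
  have hemb : IsOpenEmbedding ((φ x).source.domRestrict E.s) := by
    have h1 := (φ x).isOpenEmbedding_restrict
    rwa [← hφs x] at h1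
  have h2 := hemb.measurableEmbedding.measurableSet_image.2 (measurable_subtype_coe hB)
  have h3 : E.s '' B = (φ x).source.domRestrict E.s '' (Subtype.val ⁻¹' B) := by
    ext v
    constructor
    · rintro ⟨e, he, rfl⟩
      exact ⟨⟨e, hBx he⟩, he, rfl⟩
    · rintro ⟨e, he, rfl⟩
      exact ⟨e, he, rfl⟩
  rw [h3]
  exact h2

/-! ### The measures `ν_n` and their limit -/

variable [MeasurableSpace V]

/-- The distribution of the range of a boundary path of length at least `n`. -/
noncomputable def rangeMeasure (ν : Measure E.BoundaryPath) (n : ℕ) : Measure V :=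
  (ν.restrict (E.pathsOfLengthGE n)).map BoundaryPath.range

theorem rangeMeasure_zero {ν : Measure E.BoundaryPath} :
    rangeMeasure ν 0 = ν.map BoundaryPath.range := by
  rw [rangeMeasure, pathsOfLengthGE_zero, Measure.restrict_univ]

theorem rangeMeasure_apply [BorelSpace V] {ν : Measure E.BoundaryPath} (n : ℕ)
    {B : Set V} (hB : MeasurableSet B) :
    rangeMeasure ν n B = ν (BoundaryPath.range ⁻¹' B ∩ E.pathsOfLengthGE n) := by
  have hm := BoundaryPath.continuous_range (E := E).measurable
  rw [rangeMeasure, Measure.map_apply hm hB, Measure.restrict_apply (hm hB)]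

theorem IsInvariantMeasure.isFiniteMeasureOnCompacts_rangeMeasure [T2Space V] [T2Space W]
    [BorelSpace V] {ν : Measure E.BoundaryPath} (hν : E.IsInvariantMeasure ν) (n : ℕ) :
    IsFiniteMeasureOnCompacts (rangeMeasure ν n) :=
  ⟨fun K hK => by
    rw [rangeMeasure_apply n hK.measurableSet]
    exact (measure_mono inter_subset_left).trans_lt (hν.measure_preimage_range_lt_top hK)⟩

theorem IsInvariantMeasure.tendsto_rangeMeasure [T2Space V] [T2Space W] [BorelSpace V]
    {ν : Measure E.BoundaryPath} (hν : E.IsInvariantMeasure ν) {K : Set V} (hK : IsCompact K) :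
    Tendsto (fun n => rangeMeasure ν n K) atTop
      (𝓝 (ν (BoundaryPath.range ⁻¹' K ∩ E.infinitePaths))) := by
  have hm := BoundaryPath.continuous_range (E := E).measurable hK.measurableSet
  rw [← iInter_pathsOfLengthGE, inter_iInter]
  simp_rw [rangeMeasure_apply _ hK.measurableSet]
  exact tendsto_measure_iInter_atTop
    (fun n => (hm.inter (measurableSet_pathsOfLengthGE n)).nullMeasurableSet)
    (fun m n hmn => inter_subset_inter_right _ (antitone_pathsOfLengthGE hmn))
    ⟨0, ((measure_mono inter_subset_left).trans_lt
      (hν.measure_preimage_range_lt_top hK)).ne⟩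

theorem IsInvariantMeasure.measure_infinitePaths_eq_zero_iff [T2Space V] [T2Space W]
    [LocallyCompactSpace V] [SecondCountableTopology V] [BorelSpace V]
    {ν : Measure E.BoundaryPath} (hν : E.IsInvariantMeasure ν) :
    ν E.infinitePaths = 0 ↔ ∀ f : V → ℂ, Continuous f → HasCompactSupport f →
      Tendsto (fun n : ℕ => ∫ v, f v ∂(rangeMeasure ν n)) atTop (𝓝 0) := by
  have hfin := hν.isFiniteMeasureOnCompacts_rangeMeasure
  constructor
  · intro h f hf hfc
    obtain ⟨M, hM⟩ := hf.bounded_above_of_compact_support hfc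
    have hlim := hν.tendsto_rangeMeasure hfc
    rw [measure_mono_null inter_subset_right h] at hlim
    have hreal := ((ENNReal.tendsto_toReal ENNReal.zero_ne_top).comp hlim).const_mul M
    rw [ENNReal.toReal_zero, mul_zero] at hreal
    refine squeeze_zero_norm (fun n => ?_) hreal
    -- The integral is bounded by `M ν_n(supp f)`, which tends to `0`.
    rw [← setIntegral_eq_integral_of_forall_compl_eq_zero (s := tsupport f)
      fun x hx => image_eq_zero_of_notMem_tsupport hx]
    exact norm_setIntegral_le_of_norm_le_const hfc.measure_lt_top fun x _ => hM x
  · intro h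
    refine measure_eq_zero_of_forall_preimage_range fun K hK => ?_
    -- A compactly supported `f ≥ 0` equal to `1` on `K` gives `ν_n(K) ≤ ∫ f dν_n → 0`.
    obtain ⟨f, hf1, -, hfc, hf01⟩ := exists_continuous_one_zero_of_isCompact hK isClosed_empty
      (disjoint_empty K)
    have hlim := h (fun v => (f v : ℂ)) (Complex.continuous_ofReal.comp f.continuous)
      (hfc.comp_left Complex.ofReal_zero)
    simp_rw [integral_complex_ofReal] at hlim
    have hre : Tendsto (fun n : ℕ => ∫ v, f v ∂(rangeMeasure ν n)) atTop (𝓝 0) := by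
      have := (Complex.continuous_re.tendsto 0).comp hlim
      simpa [Function.comp_def] using this
    have hK0 : Tendsto (fun n => ((rangeMeasure ν n) K).toReal) atTop (𝓝 0) := by
      refine squeeze_zero (fun n => ENNReal.toReal_nonneg) (fun n => ?_) hre
      have hint : Integrable (fun v => f v) (rangeMeasure ν n) :=
        f.continuous.integrable_of_hasCompactSupport hfc
      calc ((rangeMeasure ν n) K).toReal = ∫ v, K.indicator 1 v ∂(rangeMeasure ν n) := by
            rw [integral_indicator_one hK.measurableSet]; rfl
        _ ≤ _ := by
          refine integral_mono ((integrable_indicator_iff hK.measurableSet).2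
            (integrableOn_const hK.measure_lt_top.ne)) hint fun v => ?_
          by_cases hv : v ∈ K
          · rw [indicator_of_mem hv, hf1 hv]
          · rw [indicator_of_notMem hv]
            exact (hf01 v).1
    have hlim' := (ENNReal.tendsto_toReal ((measure_mono inter_subset_left).trans_lt
      (hν.measure_preimage_range_lt_top hK)).ne).comp (hν.tendsto_rangeMeasure hK)
    refine (ENNReal.toReal_eq_zero_iff _).1 (tendsto_nhds_unique hlim' hK0) |>.resolve_right ?_
    exact ((measure_mono inter_subset_left).trans_lt (hν.measure_preimage_range_lt_top hK)).ne

/-! ### The action of `T` on the measures `ν_n` -/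

variable [MeasurableSpace W]

section Pullback

variable [T2Space V] [SecondCountableTopology W] [BorelSpace V] [BorelSpace W]

/-- By injectivity the fibre over `v` meets `C` in one point if `v ∈ s(C)` and in none otherwise. -/
theorem pullback_apply_of_injOn (μ : Measure V) {C : Set W} (hC : MeasurableSet C)
    (hinj : InjOn E.s C) (hsC : MeasurableSet (E.s '' C)) :
    E.pullback μ C = μ (E.s '' C) := by
  rw [pullback, Measure.bind_apply hC E.measurable_fiber_count.aemeasurable,
    ← lintegral_indicator_one hsC]
  refine lintegral_congr fun v => ?_
  have hv : MeasurableSet (E.s ⁻¹' {v}) :=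
    E.isLocalHomeomorph_s.continuous.measurable (measurableSet_singleton v)
  rw [Measure.restrict_apply hC, Measure.count_apply (hC.inter hv)]
  by_cases hmem : v ∈ E.s '' C
  · rw [indicator_of_mem hmem]
    obtain ⟨e, he, rfl⟩ := hmem
    have : C ∩ E.s ⁻¹' {E.s e} = {e} := by
      ext f
      simp only [mem_inter_iff, mem_preimage, mem_singleton_iff]
      exact ⟨fun h => hinj h.1 he h.2, by rintro rfl; exact ⟨he, rfl⟩⟩
    rw [this]
    simp
  · rw [indicator_of_notMem hmem]
    have : C ∩ E.s ⁻¹' {v} = ∅ := by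
      ext f
      simp only [mem_inter_iff, mem_preimage, mem_singleton_iff, mem_empty_iff_false, iff_false]
      rintro ⟨h1, h2⟩
      exact hmem ⟨f, h1, h2⟩
    rw [this]
    simp

end Pullback

section RangeMeasure

variable [BorelSpace V] {ν : Measure E.BoundaryPath} [T2Space V]
  [SecondCountableTopology W] [BorelSpace W]

/-- Invariance yields this directly where `s` is injective. For general `C`, both sides are measures
in `C`, compared on a countable cover by such open sets. -/
theorem pullback_rangeMeasure_apply (hν : E.IsInvariantMeasure ν) (n : ℕ) {C : Set W}
    (hC : MeasurableSet C) :
    E.pullback (rangeMeasure ν n) C =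
      ν (E.edgeCylinder 0 C ∩ E.pathsOfLengthGE (n + 1)) := by
  rcases isEmpty_or_nonempty W with hW | ⟨⟨w⟩⟩
  · have h1 : E.edgeCylinder 0 C = ∅ := by
      ext α
      simp [edgeCylinder]
    rw [h1, empty_inter, measure_empty, Measure.eq_zero_of_isEmpty (E.pullback _)]
    rfl
  -- The right-hand side is realised as the image of a restriction of `ν` under the first-edge map.
  -- Its default value `w` is taken only on paths of length `0`, which the restriction excludes.
  have hpre : ∀ B : Set W, (fun α : E.BoundaryPath => (α.edge? 0).getD w) ⁻¹' B ∩
      E.edgeCylinder 0 univ = E.edgeCylinder 0 B := by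
    intro B
    ext α
    constructor
    · rintro ⟨h, e, -, he⟩
      rw [mem_preimage, he] at h
      exact ⟨e, h, he⟩
    · rintro ⟨e, h, he⟩
      refine ⟨?_, e, trivial, he⟩
      rw [mem_preimage, he]
      exact h
  have hcyl : MeasurableSet (E.edgeCylinder 0 univ) :=
    (isOpen_edgeCylinder 0 isOpen_univ).measurableSet
  have hg : Measurable fun α : E.BoundaryPath => (α.edge? 0).getD w := by
    intro B hB
    have h : (fun α : E.BoundaryPath => (α.edge? 0).getD w) ⁻¹' B =
        E.edgeCylinder 0 B ∪ ({_α | w ∈ B} ∩ (E.edgeCylinder 0 univ)ᶜ) := by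
      rw [← hpre B]
      ext α
      rcases he : α.edge? 0 with _ | e <;> simp [edgeCylinder, he]
    rw [h]
    exact (measurableSet_edgeCylinder 0 hB).union ((MeasurableSet.const _).inter hcyl.compl)
  have hsub : E.pathsOfLengthGE (n + 1) ⊆ E.edgeCylinder 0 univ := fun α hα => by
    obtain ⟨e, he⟩ := hα 0 n.succ_pos
    exact ⟨e, trivial, he⟩
  have hmap : ∀ B : Set W, MeasurableSet B →
      (ν.restrict (E.pathsOfLengthGE (n + 1))).map (fun α => (α.edge? 0).getD w) B =
        ν (E.edgeCylinder 0 B ∩ E.pathsOfLengthGE (n + 1)) := by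
    intro B hB
    rw [Measure.map_apply hg hB, Measure.restrict_apply (hg hB), ← hpre B, inter_assoc,
      inter_eq_self_of_subset_right hsub]
  obtain ⟨S, hSc, hSu, hS⟩ := E.exists_countable_cover_injOn_source
  rw [← hmap C hC]
  congr 1
  refine (Measure.ext_iff_of_biUnion_eq_univ hSc hSu).2 fun D hD => ?_
  obtain ⟨hDo, hDi, hDm⟩ := hS D hD
  ext B hB
  have hBD : MeasurableSet (B ∩ D) := hB.inter hDo.measurableSet
  have hi : InjOn E.s (B ∩ D) := hDi.mono inter_subset_right
  have hm : MeasurableSet (E.s '' (B ∩ D)) := hDm _ inter_subset_right hBD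
  rw [Measure.restrict_apply hB, Measure.restrict_apply hB, hmap _ hBD,
    pullback_apply_of_injOn _ hBD hi hm, rangeMeasure_apply n hm,
    ← shift_image_edgeCylinder_inter]
  refine hν.measure_shift_image _
    ((measurableSet_edgeCylinder 0 hBD).inter (measurableSet_pathsOfLengthGE _)) ?_
    ((injOn_shift_edgeCylinder hi).mono inter_subset_left)
  rintro α ⟨⟨e, -, he⟩, -⟩
  exact BoundaryPath.notMem_boundaryVertices he

/-- A path with a first edge has range in `B` exactly when that edge lies in `r⁻¹(B)`. -/
theorem T_rangeMeasure (hν : E.IsInvariantMeasure ν) (n : ℕ) :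
    E.T (rangeMeasure ν n) = rangeMeasure ν (n + 1) := by
  ext B hB
  have hr := E.continuous_r.measurable
  rw [T, Measure.map_apply hr hB, pullback_rangeMeasure_apply hν n (hr hB),
    rangeMeasure_apply _ hB]
  congr 1
  ext α
  refine and_congr_left fun hα => ?_
  obtain ⟨e, he⟩ := hα 0 n.succ_pos
  rw [mem_preimage, BoundaryPath.range_eq_of_edge?_zero he]
  constructor
  · rintro ⟨f, hf, h⟩
    rw [he, Option.some.injEq] at h
    exact h ▸ hf
  · exact fun h => ⟨e, h, he⟩

theorem iterate_T_map_range (hν : E.IsInvariantMeasure ν) (n : ℕ) :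
    E.T^[n] (ν.map BoundaryPath.range) = rangeMeasure ν n := by
  induction n with
  | zero => exact rangeMeasure_zero.symm
  | succ n ih => rw [Function.iterate_succ_apply', ih, T_rangeMeasure hν]

variable [T2Space W] [LocallyCompactSpace V] [SecondCountableTopology V]

theorem IsInvariantMeasure.measure_compl_infinitePaths_eq_zero_iff
    (hν : E.IsInvariantMeasure ν) :
    ν E.infinitePathsᶜ = 0 ↔
      E.T (ν.map BoundaryPath.range) = ν.map BoundaryPath.range := by
  constructor
  · intro h
    rw [← rangeMeasure_zero, T_rangeMeasure hν, rangeMeasure, rangeMeasure]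
    congr 1
    -- Infinite paths have length at least `n`, so restricting `ν` to those lengths changes nothing.
    have hnull : ∀ n, ν (E.pathsOfLengthGE n)ᶜ = 0 := fun n =>
      measure_mono_null (compl_subset_compl.2 (by
        rw [← iInter_pathsOfLengthGE]; exact iInter_subset _ n)) h
    have hres : ∀ n, ν.restrict (E.pathsOfLengthGE n) = ν := fun n =>
      Measure.restrict_eq_self_of_ae_mem (mem_ae_iff.2 (hnull n))
    rw [hres, hres]
  · intro h
    refine measure_eq_zero_of_forall_preimage_range fun K hK => ?_
    rw [← iInter_pathsOfLengthGE, compl_iInter, inter_iUnion]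
    refine measure_iUnion_null fun n => ?_
    have hn : rangeMeasure ν n K = rangeMeasure ν 0 K := by
      rw [← iterate_T_map_range hν, ← iterate_T_map_range hν, Function.iterate_fixed h]
      rfl
    rw [rangeMeasure_apply _ hK.measurableSet, rangeMeasure_apply _ hK.measurableSet,
      pathsOfLengthGE_zero, inter_univ] at hn
    -- The paths of length at least `n` carry the full measure of `r⁻¹(K)`. As it is finite, it can
    -- be cancelled.
    have hadd := measure_inter_add_sdiff (μ := ν) (BoundaryPath.range ⁻¹' K)
      (measurableSet_pathsOfLengthGE (E := E) n)
    rw [hn] at hadd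
    rw [← Set.sdiff_eq]
    exact (ENNReal.add_right_inj (hν.measure_preimage_range_lt_top hK).ne).1
      (hadd.trans (add_zero _).symm)

end RangeMeasure

end Measures

end TopologicalGraph

theorem proposition2p6 {V : Type u} {W : Type v}
    [TopologicalSpace V] [LocallyCompactSpace V] [T2Space V] [SecondCountableTopology V]
    [MeasurableSpace V] [BorelSpace V]
    [TopologicalSpace W] [LocallyCompactSpace W] [T2Space W] [SecondCountableTopology W]
    [MeasurableSpace W] [BorelSpace W]
    (E : TopologicalGraph V W) (ν : Measure E.BoundaryPath) (hν : E.IsInvariantMeasure ν)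
    (μ : Measure V) (hμ : μ = ν.map TopologicalGraph.BoundaryPath.range) :
    (∀ n : ℕ, (E.T^[n] μ).Regular) ∧
    (ν E.infinitePathsᶜ = 0 ↔ E.T μ = μ) ∧
    (ν E.singularFinitePathsᶜ = 0 ↔
      ∀ f : V → ℂ, Continuous f → HasCompactSupport f →
        Tendsto (fun n : ℕ => ∫ v, f v ∂(E.T^[n] μ)) atTop (𝓝 0)) := by
  subst hμ
  simp_rw [TopologicalGraph.iterate_T_map_range hν, TopologicalGraph.compl_singularFinitePaths]
  refine ⟨fun n => ?_, hν.measure_compl_infinitePaths_eq_zero_iff,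
    hν.measure_infinitePaths_eq_zero_iff⟩
  -- On a second countable locally compact Hausdorff space, finiteness on compact sets implies
  -- regularity.
  have := hν.isFiniteMeasureOnCompacts_rangeMeasure n
  infer_instance
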